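/- Let $V\neq 0$, $W$ and $V'$ be finite-dimensional complex vector spaces and let $\beta:V\otimes W\to V'$ be a linear map that is strongly non-degenerate, i.e. $\beta(-,w):V\to V'$ is injective for every $0\ne w\in W$. Let $\mathbb{P}V$ be the projective space of lines in $V$, regarded as an algebraic variety with structure sheaf $\mathcal{O}_{\mathbb{P}V}$. Let $\mathcal{S}_\beta\subseteq \mathcal{O}_{\mathbb{P}V}\otimes V'$ be the subbundle whose fiber over the line $\mathrm{span}\{v\}$ is $\mathrm{Im}\,\beta(v,-)$, let $\mathcal{Q}_\beta:=(\mathcal{O}_{\mathbb{P}V}\otimes V')/\mathcal{S}_\beta$, and let $\pi:\mathcal{O}_{\mathbb{P}V}\otimes V'\to\mathcal{Q}_\beta$ be the quotient map. Epimorphisms are understood in the category of sheaves of $\mathcal{O}_{\mathbb{P}V}$-modules. (a) There is a bijection $\lambda\mapsto\varphi_\lambda$ from the set of non-zero functionals $\lambda:V'\to\mathbb{C}$ that annihilate $\mathrm{Im}\,\beta$ (the image of $V\otimes W$ in $V'$) onto the set of epimorphisms $\mathcal{Q}_\beta\to\mathcal{O}_{\mathbb{P}V}$, such that $\varphi_\lambda\circ\pi$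 is the morphism $\mathcal{O}_{\mathbb{P}V}\otimes V'\to\mathcal{O}_{\mathbb{P}V}$ induced by $\lambda$. (b) An epimorphism $\mathcal{Q}_\beta\to\mathcal{O}_{\mathbb{P}V}$ exists if and only if $\beta:V\otimes W\to V'$ is not onto. (c) Every epimorphism $\varphi:\mathcal{Q}_\beta\to\mathcal{O}_{\mathbb{P}V}$ splits: there is a morphism $\sigma:\mathcal{O}_{\mathbb{P}V}\to\mathcal{Q}_\beta$ with $\varphi\circ\sigma=\mathrm{id}$. -/

import Mathlib

open CategoryTheory TopologicalSpace Opposite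

universe u w

noncomputable section

namespace PairingBundle

/-! ### The projective space of lines in `V`, as a complex algebraic variety -/

/-- The projective space `ℙ V` of lines in the complex vector space `V`
(it will carry the Zariski topology). -/
def ProjSpace (V : Type u) [AddCommGroup V] [Module ℂ V] : Type u := Projectivization ℂ V

section Regular

variable {V : Type u} [AddCommGroup V] [Module ℂ V]

/-- The value at `v ∈ V` of a polynomial expression `P` in linear functionals on `V`.
If `P` is homogeneous of degree `d`, then this is a form of degree `d` on `V`, and
every form arises in this way. -/
def evalForm (P : MvPolynomial (Module.Dual ℂ V) ℂ) (v : V) : ℂ :=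
  MvPolynomial.eval (fun l : Module.Dual ℂ V => l v) P

/-- A nonzero vector on the line `x`. -/
def ProjSpace.rep (x : ProjSpace V) : V := Projectivization.rep x

/-- The Zariski topology: generated by the complements of the zero loci of forms. -/
instance : TopologicalSpace (ProjSpace V) :=
  TopologicalSpace.generateFrom
    {S | ∃ (d : ℕ) (P : MvPolynomial (Module.Dual ℂ V) ℂ), P.IsHomogeneous d ∧
      S = {x : ProjSpace V | evalForm P x.rep ≠ 0}}

/-- A function on an open set `U ⊆ ℙ V` is regular if locally it is a quotient `P / Q` of two
forms of the same degree, with `Q` nowhere zero. -/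
def IsRegularFn {U : Opens (ProjSpace V)} (f : U → ℂ) : Prop :=
  ∀ x : U, ∃ (N : Opens (ProjSpace V)) (_ : x.1 ∈ N) (i : N ≤ U)
    (d : ℕ) (P Q : MvPolynomial (Module.Dual ℂ V) ℂ),
    P.IsHomogeneous d ∧ Q.IsHomogeneous d ∧
      ∀ y : N, evalForm Q y.1.rep ≠ 0 ∧
        f ⟨y.1, i y.2⟩ = evalForm P y.1.rep / evalForm Q y.1.rep

lemma IsRegularFn.const {U : Opens (ProjSpace V)} (c : ℂ) :
    IsRegularFn (fun _ : U => c) := fun x =>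
  ⟨U, x.2, le_rfl, 0, MvPolynomial.C c, 1, MvPolynomial.isHomogeneous_C _ _,
    MvPolynomial.isHomogeneous_one _ _, fun y => by simp [evalForm]⟩

lemma IsRegularFn.add {U : Opens (ProjSpace V)} {f g : U → ℂ}
    (hf : IsRegularFn f) (hg : IsRegularFn g) : IsRegularFn (fun x => f x + g x) := by
  intro x
  obtain ⟨N, hN, i, d, P, Q, hP, hQ, h⟩ := hf x
  obtain ⟨N', hN', i', d', P', Q', hP', hQ', h'⟩ := hg x
  refine ⟨N ⊓ N', ⟨hN, hN'⟩, inf_le_left.trans i, d + d', P * Q' + Q * P', Q * Q',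
    (hP.mul hQ').add (hQ.mul hP'), hQ.mul hQ', fun y => ?_⟩
  obtain ⟨h1, h2⟩ := h ⟨y.1, y.2.1⟩
  obtain ⟨h3, h4⟩ := h' ⟨y.1, y.2.2⟩
  simp only [evalForm, map_mul, map_add] at *
  exact ⟨mul_ne_zero h1 h3, by rw [h2, h4, div_add_div _ _ h1 h3]⟩

lemma IsRegularFn.mul {U : Opens (ProjSpace V)} {f g : U → ℂ}
    (hf : IsRegularFn f) (hg : IsRegularFn g) : IsRegularFn (fun x => f x * g x) := by
  intro x
  obtain ⟨N, hN, i, d, P, Q, hP, hQ, h⟩ := hf x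
  obtain ⟨N', hN', i', d', P', Q', hP', hQ', h'⟩ := hg x
  refine ⟨N ⊓ N', ⟨hN, hN'⟩, inf_le_left.trans i, d + d', P * P', Q * Q',
    hP.mul hP', hQ.mul hQ', fun y => ?_⟩
  obtain ⟨h1, h2⟩ := h ⟨y.1, y.2.1⟩
  obtain ⟨h3, h4⟩ := h' ⟨y.1, y.2.2⟩
  simp only [evalForm, map_mul] at *
  exact ⟨mul_ne_zero h1 h3, by rw [h2, h4, div_mul_div_comm]⟩

lemma IsRegularFn.res {U U' : Opens (ProjSpace V)} (j : U' ≤ U) {f : U → ℂ} (hf : IsRegularFn f) :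
    IsRegularFn (fun x : U' => f ⟨x.1, j x.2⟩) := by
  intro x
  obtain ⟨N, hN, i, d, P, Q, hP, hQ, h⟩ := hf ⟨x.1, j x.2⟩
  exact ⟨N ⊓ U', ⟨hN, x.2⟩, inf_le_right, d, P, Q, hP, hQ, fun y => h ⟨y.1, y.2.1⟩⟩

lemma IsRegularFn.of_local {U : Opens (ProjSpace V)} {f : U → ℂ}
    (h : ∀ x : U, ∃ (N : Opens (ProjSpace V)) (_ : x.1 ∈ N) (i : N ≤ U),
      IsRegularFn (fun y : N => f ⟨y.1, i y.2⟩)) : IsRegularFn f := by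
  intro x
  obtain ⟨N, hN, i, hreg⟩ := h x
  obtain ⟨N', hN', i', d, P, Q, hP, hQ, hPQ⟩ := hreg ⟨x.1, hN⟩
  exact ⟨N', hN', i'.trans i, d, P, Q, hP, hQ, hPQ⟩

end Regular

/-! ### The structure sheaf -/

section Sheaves

variable (V : Type u) [AddCommGroup V] [Module ℂ V]

/-- The ring of regular functions on an open subset of `ℙ V`. -/
def regularFunctions (U : Opens (ProjSpace V)) : Subring (U → ℂ) where
  carrier := {f | IsRegularFn f}
  mul_mem' hf hg := hf.mul hg
  one_mem' := IsRegularFn.const 1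
  add_mem' hf hg := hf.add hg
  zero_mem' := IsRegularFn.const 0
  neg_mem' {f} hf := by
    have h := (IsRegularFn.const (U := U) (-1)).mul hf
    simp only [neg_mul, one_mul] at h
    exact h

variable {V} in
/-- Restriction of regular functions. -/
def restrictRegular {U U' : Opens (ProjSpace V)} (j : U' ≤ U) :
    regularFunctions V U →+* regularFunctions V U' where
  toFun f := ⟨fun x => f.1 ⟨x.1, j x.2⟩, IsRegularFn.res j f.2⟩
  map_one' := rfl
  map_mul' _ _ := rfl
  map_zero' := rfl
  map_add' _ _ := rfl

/-- Regularity is a local condition. -/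
def regularLocalPredicate :
    TopCat.LocalPredicate (X := TopCat.of (ProjSpace V)) (fun _ => ℂ) where
  pred {_} f := IsRegularFn f
  res i _ hf := IsRegularFn.res i.le hf
  locality _ h := IsRegularFn.of_local fun x =>
    let ⟨N, hN, i, hreg⟩ := h x
    ⟨N, hN, i.le, hreg⟩

/-- The sheaf of rings `𝒪` of regular functions on `ℙ V`. -/
def structureSheaf :
    Sheaf (Opens.grothendieckTopology (TopCat.of (ProjSpace V))) RingCat.{u} where
  obj :=
    { obj := fun U => RingCat.of (regularFunctions V U.unop)
      map := fun h => RingCat.ofHom (restrictRegular h.unop.le)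
      map_id := fun _ => rfl
      map_comp := fun _ _ => rfl }
  property := by
    rw [CategoryTheory.Presheaf.isSheaf_iff_isSheaf_forget _ _ (CategoryTheory.forget RingCat)]
    exact (TopCat.subsheafToTypes (regularLocalPredicate V)).property

/-- The category of sheaves of `𝒪`-modules on `ℙ V`. -/
abbrev Modules := SheafOfModules.{u} (structureSheaf V)

/-- The structure sheaf as a sheaf of modules over itself. -/
abbrev structureModule : Modules V := SheafOfModules.unit (structureSheaf V)

/-! ### Trivial bundles and their fibrewise defined subsheaves -/

variable {V}
variable {V' : Type u} [AddCommGroup V'] [Module ℂ V']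

/-- For a family of subspaces `E x ⊆ V'`, `x ∈ ℙ V`: the module of those regular maps `s : U → V'`
(all of whose coordinates are regular functions) such that `s x ∈ E x` for every `x ∈ U`. -/
def regularSections (E : ProjSpace V → Submodule ℂ V') (U : Opens (ProjSpace V)) :
    Submodule (regularFunctions V U) (U → V') where
  carrier := {s | (∀ l : Module.Dual ℂ V', IsRegularFn fun x => l (s x)) ∧ ∀ x : U, s x ∈ E x.1}
  add_mem' {s t} hs ht :=
    ⟨fun l => by simpa using (hs.1 l).add (ht.1 l), fun x => (E x.1).add_mem (hs.2 x) (ht.2 x)⟩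
  zero_mem' := ⟨fun l => by simpa using IsRegularFn.const (U := U) 0, fun x => (E x.1).zero_mem⟩
  smul_mem' f s hs :=
    ⟨fun l => by
      have h := IsRegularFn.mul f.2 (hs.1 l)
      have e : (fun x => l ((f • s) x)) = fun x => f.1 x * l (s x) := by
        funext x
        exact map_smul l (f.1 x) (s x)
      rw [e]
      exact h, fun x => (E x.1).smul_mem (f.1 x) (hs.2 x)⟩

/-- Restriction of sections. -/
def restrictSections (E : ProjSpace V → Submodule ℂ V') {U U' : Opens (ProjSpace V)}
    (j : U' ≤ U) : regularSections E U →+ regularSections E U' where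
  toFun s := ⟨fun x => s.1 ⟨x.1, j x.2⟩,
    fun l => IsRegularFn.res j (s.2.1 l), fun x => s.2.2 ⟨x.1, j x.2⟩⟩
  map_zero' := rfl
  map_add' _ _ := rfl

/-- The condition defining `regularSections` is local. -/
def sectionLocalPredicate (E : ProjSpace V → Submodule ℂ V') :
    TopCat.LocalPredicate (X := TopCat.of (ProjSpace V)) (fun _ => V') where
  pred {U} s := (∀ l : Module.Dual ℂ V', IsRegularFn (U := U) fun x => l (s x)) ∧
    ∀ x : U, s x ∈ E x.1
  res i _ hs := ⟨fun l => IsRegularFn.res i.le (hs.1 l), fun x => hs.2 ⟨x.1, i.le x.2⟩⟩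
  locality _ h := ⟨fun l => IsRegularFn.of_local fun x =>
      let ⟨N, hN, i, hs⟩ := h x
      ⟨N, hN, i.le, hs.1 l⟩,
    fun x =>
      let ⟨_, hN, _, hs⟩ := h x
      hs.2 ⟨x.1, hN⟩⟩

/-- The presheaf of abelian groups of regular sections. -/
def sectionPresheaf (E : ProjSpace V → Submodule ℂ V') :
    (Opens (TopCat.of (ProjSpace V)))ᵒᵖ ⥤ Ab.{u} where
  obj U := AddCommGrpCat.of (regularSections E U.unop)
  map h := AddCommGrpCat.ofHom (restrictSections E h.unop.le)
  map_id _ := rfl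
  map_comp _ _ := rfl

instance (E : ProjSpace V → Submodule ℂ V') (U : (Opens (TopCat.of (ProjSpace V)))ᵒᵖ) :
    Module ((structureSheaf V).obj.obj U) ((sectionPresheaf E).obj U) :=
  inferInstanceAs (Module (regularFunctions V U.unop) (regularSections E U.unop))

/-- The sheaf of `𝒪`-modules of regular maps to `V'` with values in the subspaces `E x`. -/
def sectionSheaf (E : ProjSpace V → Submodule ℂ V') : Modules V where
  val := PresheafOfModules.ofPresheaf (sectionPresheaf E) (fun _ _ _ _ _ => rfl)
  isSheaf := by
    rw [CategoryTheory.Presheaf.isSheaf_iff_isSheaf_forget _ _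
      (CategoryTheory.forget AddCommGrpCat)]
    exact (TopCat.subsheafToTypes (sectionLocalPredicate E)).property

/-- The inclusion of sheaves coming from an inclusion `E x ⊆ E' x` of families of subspaces. -/
def sectionInclusion {E E' : ProjSpace V → Submodule ℂ V'} (h : E ≤ E') :
    sectionSheaf E ⟶ sectionSheaf E' where
  val := PresheafOfModules.homMk
    { app := fun U => AddCommGrpCat.ofHom
        (AddMonoidHom.mk' (fun s : regularSections E U.unop =>
          (⟨s.1, s.2.1, fun x => h x.1 (s.2.2 x)⟩ : regularSections E' U.unop))
          (fun _ _ => rfl))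
      naturality := fun _ _ _ => rfl }
    (fun _ _ _ => rfl)

variable (V V') in
/-- The trivial bundle `𝒪 ⊗ V'` on `ℙ V`: the sheaf of all regular maps to `V'`. -/
def trivialBundle : Modules V := sectionSheaf (fun _ : ProjSpace V => (⊤ : Submodule ℂ V'))

variable (V) in
/-- The morphism `𝒪 ⊗ V' ⟶ 𝒪`, `s ↦ l ∘ s`, induced by a functional `l : V' → ℂ`. -/
def functionalMap (l : Module.Dual ℂ V') : trivialBundle V V' ⟶ structureModule V where
  val := PresheafOfModules.homMk
    { app := fun U => AddCommGrpCat.ofHom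
        (AddMonoidHom.mk' (fun s : regularSections (fun _ : ProjSpace V => (⊤ : Submodule ℂ V'))
            U.unop => (⟨fun x => l (s.1 x), s.2.1 l⟩ : regularFunctions V U.unop))
          (fun s t => Subtype.ext (funext fun x => map_add l (s.1 x) (t.1 x))))
      naturality := fun _ _ _ => rfl }
    (fun _ f s => Subtype.ext (funext fun x => map_smul l (f.1 x) (s.1 x)))

/-! ### The bundles attached to a pairing -/

variable {W : Type w} [AddCommGroup W] [Module ℂ W]

/-- `β : V × W → V'` is strongly non-degenerate if `β(-, w)` is injective for all `w ≠ 0`. -/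
def StronglyNondegenerate (β : V →ₗ[ℂ] W →ₗ[ℂ] V') : Prop :=
  ∀ w : W, w ≠ 0 → Function.Injective fun v : V => β v w

/-- The fibre `Im β(v, -) ⊆ V'` over the line spanned by `v`. -/
def fiberSpace (β : V →ₗ[ℂ] W →ₗ[ℂ] V') (x : ProjSpace V) : Submodule ℂ V' :=
  LinearMap.range (β x.rep)

/-- The subbundle `S_β` of `𝒪 ⊗ V'`, with fibre `Im β(v, -)` over the line spanned by `v`. -/
def subBundle (β : V →ₗ[ℂ] W →ₗ[ℂ] V') : Modules V := sectionSheaf (fiberSpace β)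

/-- The inclusion of `S_β` into `𝒪 ⊗ V'`. -/
def subBundleInclusion (β : V →ₗ[ℂ] W →ₗ[ℂ] V') : subBundle β ⟶ trivialBundle V V' :=
  sectionInclusion fun _ => le_top

/-- The quotient bundle `Q_β = (𝒪 ⊗ V') / S_β`. -/
def quotientBundle (β : V →ₗ[ℂ] W →ₗ[ℂ] V') : Modules V :=
  Limits.cokernel (subBundleInclusion β)

/-- The quotient map `𝒪 ⊗ V' ⟶ Q_β`. -/
def quotientMap (β : V →ₗ[ℂ] W →ₗ[ℂ] V') : trivialBundle V V' ⟶ quotientBundle β :=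
  Limits.cokernel.π (subBundleInclusion β)

end Sheaves

end PairingBundle

end

/-!
A morphism `Q_β ⟶ 𝒪` is a morphism `𝒪 ⊗ V' ⟶ 𝒪` that vanishes on `S_β`. On any open set, every
section of `𝒪 ⊗ V'` is a combination of constant sections with regular coefficients, so a morphism
`𝒪 ⊗ V' ⟶ 𝒪` is determined by the images of the constant sections, which are restrictions of global
regular functions. These are constant (`IsRegularFn.eq_of_top`), hence the morphism is induced by a
functional `l : V' → ℂ` (`exists_eq_functionalMap`). It vanishes on `S_β` exactly when `l`
annihilates `Im β`: the sections `[v] ↦ β(v, w) / ξ(v)` of `S_β`, with `ξ` a functional on `V`, fill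
every fibre (`subBundleInclusion_comp_functionalMap_eq_zero_iff`).

If `l v = 1`, then `f ↦ f v` followed by the projection to `Q_β` is a section of the morphism
induced by `l`, so `l ≠ 0` gives a split epimorphism. If `l = 0` the morphism is zero, which is not
an epimorphism because `ℙ V` is nonempty and so `𝒪 ≠ 0`.

Global regular functions are shown to be constant with Liouville's theorem: on the line through two
points `[a]` and `[b]`, a regular function is an entire function of the coordinate `t` of `[a + t b]`
and has the limit `f [b]` as `t → ∞`.
-/

namespace PairingBundle

/-! ### Forms and regular functions along lines in `ℙ V` -/

section Lines

variable {V : Type u} [AddCommGroup V] [Module ℂ V]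

lemma evalForm_smul {P : MvPolynomial (Module.Dual ℂ V) ℂ} {d : ℕ} (hP : P.IsHomogeneous d)
    (c : ℂ) (v : V) : evalForm P (c • v) = c ^ d * evalForm P v := by
  simp only [evalForm, MvPolynomial.eval_eq, Finset.mul_sum]
  refine Finset.sum_congr rfl fun m hm => ?_
  have hd : ∑ i ∈ m.support, m i = d := by
    rw [← hP (MvPolynomial.mem_support_iff.mp hm), Finsupp.weight_apply, Finsupp.sum]
    simp
  simp only [map_smul, smul_eq_mul, mul_pow, Finset.prod_mul_distrib, Finset.prod_pow_eq_pow_sum,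
    hd]
  ring

@[simp]
lemma evalForm_X (l : Module.Dual ℂ V) (v : V) : evalForm (MvPolynomial.X l) v = l v := by
  simp [evalForm]

/-- The line spanned by a nonzero vector, as a point of `ℙ V`. -/
noncomputable def ProjSpace.mk (v : V) (hv : v ≠ 0) : ProjSpace V := Projectivization.mk ℂ v hv

lemma ProjSpace.rep_ne_zero (x : ProjSpace V) : x.rep ≠ 0 := Projectivization.rep_nonzero x

lemma ProjSpace.mk_rep (x : ProjSpace V) : ProjSpace.mk x.rep x.rep_ne_zero = x :=
  Projectivization.mk_rep x

lemma ProjSpace.mk_eq_mk_of_smul {v v' : V} (hv : v ≠ 0) (hv' : v' ≠ 0) (c : ℂ)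
    (h : c • v' = v) : ProjSpace.mk v hv = ProjSpace.mk v' hv' :=
  (Projectivization.mk_eq_mk_iff' ℂ v v' hv hv').mpr ⟨c, h⟩

lemma ProjSpace.exists_rep_mk (v : V) (hv : v ≠ 0) :
    ∃ c : ℂ, c ≠ 0 ∧ (ProjSpace.mk v hv).rep = c • v := by
  obtain ⟨a, ha⟩ := Projectivization.exists_smul_eq_mk_rep ℂ v hv
  exact ⟨a, a.ne_zero, ha.symm⟩

lemma evalForm_rep_mk_ne_zero_iff {P : MvPolynomial (Module.Dual ℂ V) ℂ} {d : ℕ}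
    (hP : P.IsHomogeneous d) (v : V) (hv : v ≠ 0) :
    evalForm P (ProjSpace.mk v hv).rep ≠ 0 ↔ evalForm P v ≠ 0 := by
  obtain ⟨c, hc, h⟩ := ProjSpace.exists_rep_mk v hv
  simp [h, evalForm_smul hP, hc]

/-- The value of a quotient of two forms of the same degree does not depend on the vector chosen
on the line. -/
lemma evalForm_div_rep_mk {P Q : MvPolynomial (Module.Dual ℂ V) ℂ} {d : ℕ}
    (hP : P.IsHomogeneous d) (hQ : Q.IsHomogeneous d) (v : V) (hv : v ≠ 0) :
    evalForm P (ProjSpace.mk v hv).rep / evalForm Q (ProjSpace.mk v hv).rep =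
      evalForm P v / evalForm Q v := by
  obtain ⟨c, hc, h⟩ := ProjSpace.exists_rep_mk v hv
  rw [h, evalForm_smul hP, evalForm_smul hQ, mul_div_mul_left _ _ (pow_ne_zero d hc)]

lemma differentiable_evalForm_line (P : MvPolynomial (Module.Dual ℂ V) ℂ) (a b : V) :
    Differentiable ℂ fun t : ℂ => evalForm P (a + t • b) := by
  induction P using MvPolynomial.induction_on with
  | C c => simp [evalForm]
  | add p q hp hq =>
    simp only [evalForm, map_add] at *
    exact hp.add hq
  | mul_X p l hp =>
    simp only [evalForm, map_mul, MvPolynomial.eval_X, map_add, map_smul, smul_eq_mul] at *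
    exact hp.mul (by fun_prop)

/-- The Zariski topology of `ℙ V` is coarser than the classical one along lines. -/
lemma continuous_line (a b : V) (h : ∀ t : ℂ, a + t • b ≠ 0) :
    Continuous fun t : ℂ => ProjSpace.mk (a + t • b) (h t) := by
  refine continuous_generateFrom_iff.mpr ?_
  rintro _ ⟨d, P, hP, rfl⟩
  simp only [Set.preimage_ofPred_eq, evalForm_rep_mk_ne_zero_iff hP]
  exact isOpen_ne_fun (differentiable_evalForm_line P a b).continuous continuous_const

lemma IsRegularFn.differentiable_line {f : (⊤ : Opens (ProjSpace V)) → ℂ} (hf : IsRegularFn f)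
    (a b : V) (h : ∀ t : ℂ, a + t • b ≠ 0) :
    Differentiable ℂ fun t : ℂ => f ⟨ProjSpace.mk (a + t • b) (h t), trivial⟩ := by
  intro t₀
  obtain ⟨N, hN, i, d, P, Q, hP, hQ, hPQ⟩ := hf ⟨ProjSpace.mk (a + t₀ • b) (h t₀), trivial⟩
  have hQ₀ : evalForm Q (a + t₀ • b) ≠ 0 :=
    (evalForm_rep_mk_ne_zero_iff hQ _ (h t₀)).mp (hPQ ⟨_, hN⟩).1
  refine (((differentiable_evalForm_line P a b).differentiableAt).fun_div
    ((differentiable_evalForm_line Q a b).differentiableAt) hQ₀).congr_of_eventuallyEq ?_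
  filter_upwards [(continuous_line a b h).continuousAt.preimage_mem_nhds
    (N.isOpen.mem_nhds hN)] with t ht
  rw [(hPQ ⟨_, ht⟩).2, evalForm_div_rep_mk hP hQ]

/-- A global regular function takes the same value at any two points `[a] ≠ [b]`: on the line
joining them it is an entire function of the affine coordinate `t` of `[a + t b]`, and it tends
to its value at `[b]` as `t → ∞`, so Liouville's theorem applies. -/
lemma IsRegularFn.eq_of_linearIndependent {f : (⊤ : Opens (ProjSpace V)) → ℂ}
    (hf : IsRegularFn f) {a b : V} (hab : LinearIndependent ℂ ![a, b]) (ha : a ≠ 0) (hb : b ≠ 0) :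
    f ⟨ProjSpace.mk a ha, trivial⟩ = f ⟨ProjSpace.mk b hb, trivial⟩ := by
  rw [LinearIndependent.pair_iff] at hab
  have h₁ : ∀ t : ℂ, a + t • b ≠ 0 := fun t h =>
    one_ne_zero (hab 1 t (by rwa [one_smul])).1
  have h₂ : ∀ t : ℂ, b + t • a ≠ 0 := fun t h =>
    one_ne_zero (hab t 1 (by rwa [one_smul, add_comm])).2
  have hlim : Filter.Tendsto (fun t : ℂ => f ⟨ProjSpace.mk (a + t • b) (h₁ t), trivial⟩)
      (Filter.cocompact ℂ) (nhds (f ⟨ProjSpace.mk b hb, trivial⟩)) := by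
    have hc := (hf.differentiable_line b a h₂).continuous.tendsto 0
    simp only [zero_smul, add_zero] at hc
    refine (hc.comp (Filter.tendsto_inv₀_cobounded.mono_left
      Metric.cobounded_eq_cocompact.ge)).congr' ?_
    filter_upwards [(Set.finite_singleton (0 : ℂ)).isCompact.compl_mem_cocompact] with t ht
    have ht : t ≠ 0 := ht
    -- For `t ≠ 0` the vectors `a + t b` and `b + t⁻¹ a` span the same line.
    refine congrArg f (Subtype.ext (ProjSpace.mk_eq_mk_of_smul _ _ t⁻¹ ?_))
    rw [smul_add, smul_smul, inv_mul_cancel₀ ht, one_smul, add_comm]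
  have h0 := (hf.differentiable_line a b h₁).apply_eq_of_tendsto_cocompact 0 hlim
  simpa only [zero_smul, add_zero] using h0

/-- Global regular functions on `ℙ V` are constant. -/
theorem IsRegularFn.eq_of_top {f : (⊤ : Opens (ProjSpace V)) → ℂ} (hf : IsRegularFn f)
    (x y : (⊤ : Opens (ProjSpace V))) : f x = f y := by
  obtain ⟨x, hx⟩ := x
  obtain ⟨y, hy⟩ := y
  by_cases hab : LinearIndependent ℂ ![x.rep, y.rep]
  · simpa only [ProjSpace.mk_rep] using
      hf.eq_of_linearIndependent hab x.rep_ne_zero y.rep_ne_zero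
  · rw [LinearIndependent.pair_iff' x.rep_ne_zero] at hab
    push Not at hab
    obtain ⟨c, hc⟩ := hab
    have h := ProjSpace.mk_eq_mk_of_smul y.rep_ne_zero x.rep_ne_zero c hc
    simp only [ProjSpace.mk_rep] at h
    subst h
    rfl

end Lines

/-! ### Morphisms between the trivial bundle and the structure sheaf -/

section Morphisms

variable {V V' : Type u} [AddCommGroup V] [Module ℂ V] [AddCommGroup V'] [Module ℂ V']

/-- The action on sections over `U` of a morphism to `𝒪`. -/
noncomputable def sectionsHom {E : ProjSpace V → Submodule ℂ V'}
    (ψ : sectionSheaf E ⟶ structureModule V) (U : Opens (ProjSpace V)) :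
    regularSections E U →ₗ[regularFunctions V U] regularFunctions V U :=
  (ψ.val.app (op U)).hom

lemma sectionsHom_restrict {E : ProjSpace V → Submodule ℂ V'}
    (ψ : sectionSheaf E ⟶ structureModule V) {U U' : Opens (ProjSpace V)} (j : U' ≤ U)
    (s : regularSections E U) :
    sectionsHom ψ U' (restrictSections E j s) = restrictRegular j (sectionsHom ψ U s) :=
  PresheafOfModules.naturality_apply ψ.val (homOfLE j).op s

lemma hom_ext_sections {E : ProjSpace V → Submodule ℂ V'}
    {ψ ψ' : sectionSheaf E ⟶ structureModule V}
    (h : ∀ U s, sectionsHom ψ U s = sectionsHom ψ' U s) : ψ = ψ' := by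
  refine SheafOfModules.hom_ext (PresheafOfModules.hom_ext fun U => ?_)
  exact ModuleCat.hom_ext (LinearMap.ext fun s => h U.unop s)

/-- The constant section with value `v`. -/
def constSection (U : Opens (ProjSpace V)) (v : V') :
    regularSections (fun _ : ProjSpace V => (⊤ : Submodule ℂ V')) U :=
  ⟨fun _ => v, fun l => IsRegularFn.const (l v), fun _ => trivial⟩

/-- The regular function `l ∘ s`. -/
def coordinate {U : Opens (ProjSpace V)} (l : Module.Dual ℂ V')
    (s : regularSections (fun _ : ProjSpace V => (⊤ : Submodule ℂ V')) U) :
    regularFunctions V U := ⟨fun x => l (s.1 x), s.2.1 l⟩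

lemma sectionsHom_functionalMap (l : Module.Dual ℂ V') (U : Opens (ProjSpace V))
    (s : regularSections (fun _ : ProjSpace V => (⊤ : Submodule ℂ V')) U) :
    sectionsHom (functionalMap V l) U s = coordinate l s := rfl

lemma eq_sum_coordinate_smul {ι : Type*} [Fintype ι] (b : Module.Basis ι ℂ V')
    {U : Opens (ProjSpace V)}
    (s : regularSections (fun _ : ProjSpace V => (⊤ : Submodule ℂ V')) U) :
    s = ∑ i, coordinate (b.coord i) s • constSection U (b i) := by
  refine Subtype.ext (funext fun x => ?_)
  have : ((∑ i, coordinate (b.coord i) s • constSection U (b i) : regularSections _ U) :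
      U → V') x = ∑ i, b.coord i (s.1 x) • b i := by
    rw [Submodule.coe_sum, Finset.sum_apply]
    rfl
  rw [this]
  exact (b.sum_repr (s.1 x)).symm

/-- Every morphism `𝒪 ⊗ V' ⟶ 𝒪` is induced by a functional: it is determined by the images of the
constant sections, and these are global regular functions, hence constants. -/
theorem exists_eq_functionalMap [Nontrivial V] [FiniteDimensional ℂ V']
    (ψ : trivialBundle V V' ⟶ structureModule V) :
    ∃ l : Module.Dual ℂ V', ψ = functionalMap V l := by
  obtain ⟨v₀, hv₀⟩ := exists_ne (0 : V)
  let b := Module.finBasis ℂ V'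
  let c (i) : ℂ := (sectionsHom (E := fun _ => ⊤) ψ ⊤ (constSection ⊤ (b i))).1
    ⟨ProjSpace.mk v₀ hv₀, trivial⟩
  have hconst (U : Opens (ProjSpace V)) (i) (x : U) :
      (sectionsHom (E := fun _ => ⊤) ψ U (constSection U (b i))).1 x = c i := by
    have h := sectionsHom_restrict (E := fun _ => ⊤) ψ (le_top : U ≤ ⊤) (constSection ⊤ (b i))
    have hx := congrFun (congrArg Subtype.val h) x
    exact hx.trans (IsRegularFn.eq_of_top
      (sectionsHom (E := fun _ => ⊤) ψ ⊤ (constSection ⊤ (b i))).2 _ _)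
  refine ⟨b.constr ℂ c, hom_ext_sections (E := fun _ => ⊤) fun U s => ?_⟩
  rw [sectionsHom_functionalMap]
  conv_lhs => rw [eq_sum_coordinate_smul b s]
  rw [map_sum]
  refine Subtype.ext (funext fun x => ?_)
  rw [AddSubmonoidClass.coe_finsetSum, Finset.sum_apply]
  trans ∑ i, b.coord i (s.1 x) * c i
  · refine Finset.sum_congr rfl fun i _ => ?_
    rw [LinearMap.map_smul]
    exact congrArg (b.coord i (s.1 x) * ·) (hconst U i x)
  · exact (b.constr_apply_fintype ℂ c (s.1 x)).symm

lemma functionalMap_injective [Nontrivial V] :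
    Function.Injective (functionalMap V : Module.Dual ℂ V' → _) := by
  intro l l' h
  obtain ⟨v₀, hv₀⟩ := exists_ne (0 : V)
  ext v
  have h' := congrArg (fun ψ => sectionsHom (E := fun _ => ⊤) ψ ⊤ (constSection ⊤ v)) h
  exact congrFun (congrArg Subtype.val h') ⟨ProjSpace.mk v₀ hv₀, trivial⟩

/-- The morphism `𝒪 ⟶ 𝒪 ⊗ V'`, `f ↦ f v`. -/
noncomputable def vectorMap (v : V') : structureModule V ⟶ trivialBundle V V' where
  val := PresheafOfModules.homMk
    { app := fun U => AddCommGrpCat.ofHom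
        (AddMonoidHom.mk' (fun f : regularFunctions V U.unop => f • constSection U.unop v)
          (fun f g => add_smul (R := regularFunctions V U.unop) f g (constSection U.unop v)))
      naturality := fun _ _ _ => rfl }
    (fun U f g => mul_smul (α := regularFunctions V U.unop) f g (constSection U.unop v))

lemma vectorMap_comp_functionalMap (l : Module.Dual ℂ V') (v : V') (h : l v = 1) :
    vectorMap v ≫ functionalMap V l = 𝟙 (structureModule V) := by
  refine SheafOfModules.hom_ext (PresheafOfModules.hom_ext fun U => ?_)
  refine ModuleCat.hom_ext (LinearMap.ext fun f => ?_)
  refine Subtype.ext (funext fun x => ?_)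
  have : l (f.1 x • v) = f.1 x := by rw [map_smul, h, smul_eq_mul, mul_one]
  exact this

lemma id_structureModule_ne_zero [Nontrivial V] : 𝟙 (structureModule V) ≠ 0 := by
  intro h
  obtain ⟨v₀, hv₀⟩ := exists_ne (0 : V)
  have h' : (1 : regularFunctions V ⊤) = 0 := congrArg (fun ψ : structureModule V ⟶ _ =>
    (show regularFunctions V ⊤ from (ψ.val.app (op ⊤)).hom (1 : regularFunctions V ⊤))) h
  exact one_ne_zero (congrFun (congrArg Subtype.val h') ⟨ProjSpace.mk v₀ hv₀, trivial⟩)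

end Morphisms

/-! ### The quotient bundle of a pairing -/

section Pairing

variable {V V' : Type u} [AddCommGroup V] [Module ℂ V] [AddCommGroup V'] [Module ℂ V']
variable {W : Type w} [AddCommGroup W] [Module ℂ W]

/-- If `ξ` is a functional on `V`, then `[v] ↦ β(v, w) / ξ(v)` is a section of `S_β` over the open
set where `ξ ≠ 0`. -/
lemma exists_section_subBundle (β : V →ₗ[ℂ] W →ₗ[ℂ] V') (w : W) (ξ : Module.Dual ℂ V)
    (U : Opens (ProjSpace V)) (hU : ∀ x : U, ξ x.1.rep ≠ 0) :
    ∃ s : regularSections (fiberSpace β) U, ∀ x : U, s.1 x = (ξ x.1.rep)⁻¹ • β x.1.rep w := by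
  refine ⟨⟨fun x => (ξ x.1.rep)⁻¹ • β x.1.rep w, fun l x => ?_, fun x => ?_⟩, fun _ => rfl⟩
  · refine ⟨U, x.2, le_rfl, 1, MvPolynomial.X (l ∘ₗ β.flip w), MvPolynomial.X ξ,
      MvPolynomial.isHomogeneous_X _ _, MvPolynomial.isHomogeneous_X _ _, fun y => ?_⟩
    simp only [evalForm_X]
    refine ⟨hU y, ?_⟩
    simp [div_eq_inv_mul]
  · exact Submodule.smul_mem _ _ (LinearMap.mem_range_self _ _)

/-- The morphism `𝒪 ⊗ V' ⟶ 𝒪` induced by `l` vanishes on `S_β` if and only if `l` annihilates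
`Im β`, because local sections of `S_β` fill the fibres. -/
lemma subBundleInclusion_comp_functionalMap_eq_zero_iff (β : V →ₗ[ℂ] W →ₗ[ℂ] V')
    (l : Module.Dual ℂ V') :
    subBundleInclusion β ≫ functionalMap V l = 0 ↔ ∀ v w, l (β v w) = 0 := by
  constructor
  · intro h v w
    obtain rfl | hv := eq_or_ne v 0
    · simp
    obtain ⟨c, hc, hrep⟩ := ProjSpace.exists_rep_mk v hv
    set x := ProjSpace.mk v hv
    obtain ⟨ξ, hξ⟩ : ∃ ξ : Module.Dual ℂ V, ξ x.rep ≠ 0 := by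
      by_contra! h0
      exact x.rep_ne_zero ((Module.forall_dual_apply_eq_zero_iff ℂ _).mp h0)
    let U : Opens (ProjSpace V) := ⟨{y | evalForm (MvPolynomial.X ξ) y.rep ≠ 0},
      TopologicalSpace.isOpen_generateFrom_of_mem
        ⟨1, MvPolynomial.X ξ, MvPolynomial.isHomogeneous_X _ _, rfl⟩⟩
    have hxU : x ∈ U := by
      change evalForm (MvPolynomial.X ξ) x.rep ≠ 0
      rwa [evalForm_X]
    obtain ⟨s, hs⟩ := exists_section_subBundle β w ξ U fun y => by
      rw [← evalForm_X ξ]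
      exact y.2
    have h' := congrArg (fun ψ => sectionsHom (E := fiberSpace β) ψ U s) h
    have h₀ : l (s.1 ⟨x, hxU⟩) = 0 := congrFun (congrArg Subtype.val h') ⟨x, hxU⟩
    have hξv : ξ v ≠ 0 := fun h => hξ (by simp [hrep, h])
    simpa [hs, hrep, hc, hξv] using h₀
  · intro h
    refine hom_ext_sections (E := fiberSpace β) fun U s => Subtype.ext (funext fun x => ?_)
    obtain ⟨w, hw⟩ := s.2.2 x
    have : l (s.1 x) = 0 := by rw [← hw, h]
    exact this

lemma forall_mem_range_lift_iff (β : V →ₗ[ℂ] W →ₗ[ℂ] V') (l : Module.Dual ℂ V') :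
    (∀ z ∈ LinearMap.range (TensorProduct.lift β), l z = 0) ↔ ∀ v w, l (β v w) = 0 := by
  constructor
  · exact fun h v w => h _ ⟨v ⊗ₜ w, TensorProduct.lift.tmul v w⟩
  · rintro h _ ⟨t, rfl⟩
    induction t with
    | zero => simp
    | tmul v w => simpa using h v w
    | add s t hs ht => rw [map_add, map_add, hs, ht, add_zero]

lemma subBundleInclusion_comp_quotientMap (β : V →ₗ[ℂ] W →ₗ[ℂ] V') :
    subBundleInclusion β ≫ quotientMap β = 0 :=
  Limits.cokernel.condition _

instance (β : V →ₗ[ℂ] W →ₗ[ℂ] V') : Epi (quotientMap β) :=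
  inferInstanceAs (Epi (Limits.cokernel.π _))

/-- Every morphism `Q_β ⟶ 𝒪` comes from a functional annihilating `Im β`. -/
lemma exists_quotientMap_comp_eq [Nontrivial V] [FiniteDimensional ℂ V']
    (β : V →ₗ[ℂ] W →ₗ[ℂ] V') (φ : quotientBundle β ⟶ structureModule V) :
    ∃ l : Module.Dual ℂ V', (∀ z ∈ LinearMap.range (TensorProduct.lift β), l z = 0) ∧
      quotientMap β ≫ φ = functionalMap V l := by
  obtain ⟨l, hl⟩ := exists_eq_functionalMap (quotientMap β ≫ φ)
  refine ⟨l, ?_, hl⟩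
  rw [forall_mem_range_lift_iff, ← subBundleInclusion_comp_functionalMap_eq_zero_iff, ← hl,
    ← Category.assoc, subBundleInclusion_comp_quotientMap, Limits.zero_comp]

/-- A vector `v` with `l v = 1` gives a section of a morphism `Q_β ⟶ 𝒪` induced by `l`. -/
lemma isSplitEpi_of_quotientMap_comp_eq {β : V →ₗ[ℂ] W →ₗ[ℂ] V'}
    {φ : quotientBundle β ⟶ structureModule V} {l : Module.Dual ℂ V'} (hl : l ≠ 0)
    (h : quotientMap β ≫ φ = functionalMap V l) : IsSplitEpi φ := by
  obtain ⟨v, hv⟩ := LinearMap.surjective hl 1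
  exact ⟨⟨⟨vectorMap v ≫ quotientMap β, by
    rw [Category.assoc, h, vectorMap_comp_functionalMap l v hv]⟩⟩⟩

lemma functional_ne_zero_of_epi [Nontrivial V] {β : V →ₗ[ℂ] W →ₗ[ℂ] V'}
    {φ : quotientBundle β ⟶ structureModule V} [Epi φ] {l : Module.Dual ℂ V'}
    (h : quotientMap β ≫ φ = functionalMap V l) : l ≠ 0 := by
  rintro rfl
  have h₀ : functionalMap V (0 : Module.Dual ℂ V') = 0 :=
    hom_ext_sections (E := fun _ => ⊤) fun _ _ => rfl
  refine id_structureModule_ne_zero (V := V) ?_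
  rw [← cancel_epi (quotientMap β ≫ φ), h, h₀, Limits.zero_comp, Limits.zero_comp]

end Pairing

end PairingBundle

open PairingBundle in
theorem mainTheorem10 {V V' : Type u} {W : Type w}
    [AddCommGroup V] [Module ℂ V] [FiniteDimensional ℂ V] [Nontrivial V]
    [AddCommGroup W] [Module ℂ W] [FiniteDimensional ℂ W]
    [AddCommGroup V'] [Module ℂ V'] [FiniteDimensional ℂ V']
    (β : V →ₗ[ℂ] W →ₗ[ℂ] V') (hβ : PairingBundle.StronglyNondegenerate β) :
    (∃ e : {l : Module.Dual ℂ V' //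
            l ≠ 0 ∧ ∀ z ∈ LinearMap.range (TensorProduct.lift β), l z = 0} ≃
          {φ : PairingBundle.quotientBundle β ⟶ PairingBundle.structureModule V // Epi φ},
        ∀ l, PairingBundle.quotientMap β ≫ (e l).1 = PairingBundle.functionalMap V l.1) ∧
      ((∃ φ : PairingBundle.quotientBundle β ⟶ PairingBundle.structureModule V, Epi φ) ↔
        ¬ Function.Surjective (TensorProduct.lift β)) ∧
      (∀ φ : PairingBundle.quotientBundle β ⟶ PairingBundle.structureModule V,
        Epi φ → IsSplitEpi φ) := by
  have hcomp (l : {l : Module.Dual ℂ V' //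
      l ≠ 0 ∧ ∀ z ∈ LinearMap.range (TensorProduct.lift β), l z = 0}) :
      ∃ φ : {φ : quotientBundle β ⟶ structureModule V // Epi φ},
        quotientMap β ≫ φ.1 = functionalMap V l.1 := by
    have h := (subBundleInclusion_comp_functionalMap_eq_zero_iff β l.1).mpr
      ((forall_mem_range_lift_iff β l.1).mp l.2.2)
    let φ : quotientBundle β ⟶ structureModule V := Limits.cokernel.desc _ _ h
    have hφ : quotientMap β ≫ φ = functionalMap V l.1 := Limits.cokernel.π_desc _ _ h
    have := isSplitEpi_of_quotientMap_comp_eq l.2.1 hφ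
    exact ⟨⟨φ, inferInstance⟩, hφ⟩
  choose e he using hcomp
  have hinj : Function.Injective e := fun l l' h =>
    Subtype.ext (functionalMap_injective (by rw [← he l, h, he l']))
  have hsurj : Function.Surjective e := by
    rintro ⟨φ, hφ⟩
    obtain ⟨l, hl, hπ⟩ := exists_quotientMap_comp_eq β φ
    refine ⟨⟨l, functional_ne_zero_of_epi hπ, hl⟩, Subtype.ext ?_⟩
    rw [← cancel_epi (quotientMap β), he, hπ]
  refine ⟨⟨Equiv.ofBijective e ⟨hinj, hsurj⟩, he⟩, ⟨?_, ?_⟩, fun φ hφ => ?_⟩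
  · rintro ⟨φ, hφ⟩ hs
    obtain ⟨l, hl, hπ⟩ := exists_quotientMap_comp_eq β φ
    exact functional_ne_zero_of_epi hπ (LinearMap.ext fun z => hl z (hs z))
  · intro hs
    obtain ⟨l, hl, hker⟩ := Submodule.exists_le_ker_of_lt_top _
      (lt_top_iff_ne_top.mpr (mt LinearMap.range_eq_top.mp hs))
    exact ⟨_, (e ⟨l, hl, fun z hz => hker hz⟩).2⟩
  · obtain ⟨l, -, hπ⟩ := exists_quotientMap_comp_eq β φ
    exact isSplitEpi_of_quotientMap_comp_eq (functional_ne_zero_of_epi hπ) hπ
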